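/- Let $G$ be a locally compact (Hausdorff) group and let $(\mathcal{B},G,\pi)$ be a Fell bundle over $G$ (with Hausdorff total space) with fibers $B_g=\pi^{-1}(g)$, whose unit fiber $B_e$ is a unital C$^*$-algebra. An element $u\in B_g$ is called unitary if $uu^*=u^*u=1_{B_e}$, and $(\mathcal{B},G,\pi)$ is called a crossed product bundle if every fiber $B_g$ contains a unitary element. The bundle is called saturated if $\operatorname{span}(B_gB_h)$ is dense in $B_{gh}$ for all $g,h\in G$. In that case each $B_g$ is a Morita equivalence $B_e$-bimodule, with the actions given by multiplication and the inner products $st^*$ (left) and $s^*t$ (right), and the Picard homomorphism $\psi_{\mathcal{B}}$ of the bundle maps $g\in G$ to the isomorphism class $\psi_{\mathcal{B}}(g)=[B_g]\in\operatorname{Pic}(B_e)$. The group $\operatorname{Out}(B_e)=\operatorname{Aut}(B_e)/\operatorname{Inn}(B_e)$ is regarded as a subset of $\operatorname{Pic}(B_e)$ via $[\alpha]\mapsto[M_\alpha]$, where $M_\alpha$ is the left Hilbert $B_e$-module $B_e$ with right action $s\,.\,b=s\alpha(b)$ and right inner product $\langle s,t\rangle=\alpha^{-1}(s^*t)$. Then: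 1. $(\mathcal{B},G,\pi)$ is a crossed product bundle if and only if it is saturated and $\psi_{\mathcal{B}}(g)\in\operatorname{Out}(B_e)$ for all $g\in G$. 2. If $(\mathcal{B},G,\pi)$ is a crossed product bundle, then $B_g=uB_e=B_eu$ for every $g\in G$ and every unitary element $u\in B_g$, and $B_gB_h=\{st : s\in B_g,\ t\in B_h\}=B_{gh}$ for all $g,h\in G$. -/

import Mathlib

open scoped ComplexConjugate

universe u v

/-! ### Bundles -/

section Bundles

/-- The fiber of `π : 𝓑 → X` over `x`.  (A structure, so that the fiber carries no topology other
than the norm topology it is given below.) -/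
@[ext]
structure Fiber {𝓑 : Type u} {X : Type v} (π : 𝓑 → X) (x : X) : Type u where
  val : 𝓑
  proj_val : π val = x

/-- An element of the total space, seen in its own fiber. -/
def Fiber.mk' {𝓑 : Type u} {X : Type v} (π : 𝓑 → X) (s : 𝓑) : Fiber π (π s) := ⟨s, rfl⟩

/-- A Banach bundle: `π` is a continuous open surjection, the fibers are complex Banach spaces, and
the norm, the fiberwise sum, the multiplication by each scalar are continuous; the last condition
is the usual one about nets `s i` with `‖s i‖ → 0` and `π (s i) → x`, with filters for nets. -/
class BanachBundle {𝓑 : Type u} {X : Type v} [TopologicalSpace 𝓑] [TopologicalSpace X]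
    (π : 𝓑 → X) where
  [normedAddCommGroup : ∀ x, NormedAddCommGroup (Fiber π x)]
  [normedSpace : ∀ x, NormedSpace ℂ (Fiber π x)]
  [completeSpace : ∀ x, CompleteSpace (Fiber π x)]
  continuous_proj : Continuous π
  isOpenMap_proj : IsOpenMap π
  surjective_proj : Function.Surjective π
  continuous_norm : Continuous fun s : 𝓑 => ‖Fiber.mk' π s‖
  continuous_add : Continuous fun p : {p : 𝓑 × 𝓑 // π p.1 = π p.2} =>
    (Fiber.mk' π p.1.1 + (⟨p.1.2, p.2.symm⟩ : Fiber π (π p.1.1))).val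
  continuous_smul : ∀ c : ℂ, Continuous fun s : 𝓑 => (c • Fiber.mk' π s).val
  tendsto_zero : ∀ (l : Filter 𝓑) (x : X),
    Filter.Tendsto (fun s : 𝓑 => ‖Fiber.mk' π s‖) l (nhds 0) → Filter.Tendsto π l (nhds x) →
      l ≤ nhds (0 : Fiber π x).val

attribute [reducible, instance] BanachBundle.normedAddCommGroup BanachBundle.normedSpace

attribute [instance] BanachBundle.completeSpace

/-- The multiplication `B_g × B_h → B_{gh}`. -/
def Fiber.mul {𝓑 : Type u} {G : Type v} [Group G] [Mul 𝓑] {π : 𝓑 → G}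
    (hπ : ∀ s t, π (s * t) = π s * π t) {g h : G} (s : Fiber π g) (t : Fiber π h) :
    Fiber π (g * h) :=
  ⟨s.val * t.val, by rw [hπ, s.proj_val, t.proj_val]⟩

/-- The involution `B_g → B_{g⁻¹}`. -/
def Fiber.adj {𝓑 : Type u} {G : Type v} [Group G] [Star 𝓑] {π : 𝓑 → G}
    (hπ : ∀ s, π (star s) = (π s)⁻¹) {g : G} (s : Fiber π g) : Fiber π g⁻¹ :=
  ⟨star s.val, by rw [hπ, s.proj_val]⟩

/-- A Fell bundle over a topological group `G`.  Associativity of the multiplication is in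
`Semigroup 𝓑`, and `(s t)* = t* s*`, `s** = s` are in `StarMul 𝓑`.  The last condition says that
`s* s` is a positive element `b* b`, `b ∈ B_e`, of the C⋆-algebra `B_e`. -/
class FellBundle {𝓑 : Type u} {G : Type v} [TopologicalSpace 𝓑] [TopologicalSpace G] [Group G]
    [Semigroup 𝓑] [StarMul 𝓑] (π : 𝓑 → G) extends BanachBundle π where
  continuous_mul : Continuous fun p : 𝓑 × 𝓑 => p.1 * p.2
  continuous_star : Continuous fun s : 𝓑 => star s
  proj_mul : ∀ s t : 𝓑, π (s * t) = π s * π t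
  add_mul : ∀ (g h : G) (s s' : Fiber π g) (t : Fiber π h),
    (s + s').mul proj_mul t = s.mul proj_mul t + s'.mul proj_mul t
  mul_add : ∀ (g h : G) (s : Fiber π g) (t t' : Fiber π h),
    s.mul proj_mul (t + t') = s.mul proj_mul t + s.mul proj_mul t'
  smul_mul : ∀ (g h : G) (c : ℂ) (s : Fiber π g) (t : Fiber π h),
    (c • s).mul proj_mul t = c • s.mul proj_mul t
  mul_smul : ∀ (g h : G) (c : ℂ) (s : Fiber π g) (t : Fiber π h),
    s.mul proj_mul (c • t) = c • s.mul proj_mul t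
  norm_mul_le : ∀ s t : 𝓑, ‖Fiber.mk' π (s * t)‖ ≤ ‖Fiber.mk' π s‖ * ‖Fiber.mk' π t‖
  proj_star : ∀ s : 𝓑, π (star s) = (π s)⁻¹
  star_add : ∀ (g : G) (s t : Fiber π g),
    (s + t).adj proj_star = s.adj proj_star + t.adj proj_star
  star_smul : ∀ (g : G) (c : ℂ) (s : Fiber π g),
    (c • s).adj proj_star = conj c • s.adj proj_star
  norm_star_mul_self : ∀ s : 𝓑, ‖Fiber.mk' π (star s * s)‖ = ‖Fiber.mk' π s‖ ^ 2
  star_mul_self_nonneg : ∀ s : 𝓑, ∃ b : 𝓑, π b = 1 ∧ star s * s = star b * b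

end Bundles

/-! ### The unit fiber as a C⋆-algebra -/

section UnitFiber

variable {𝓑 : Type u} {G : Type v} [TopologicalSpace 𝓑] [TopologicalSpace G] [Group G]
  [Semigroup 𝓑] [StarMul 𝓑] {π : 𝓑 → G} [FellBundle π]

instance unitFiberMul : Mul (Fiber π 1) where
  mul a b := ⟨a.val * b.val, by
    rw [FellBundle.proj_mul (π := π), a.proj_val, b.proj_val, mul_one]⟩

instance unitFiberStar : Star (Fiber π 1) where
  star a := ⟨star a.val, by rw [FellBundle.proj_star (π := π), a.proj_val, inv_one]⟩

/-- The unit fiber has a two-sided unit. -/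
class HasUnitalUnitFiber (π : 𝓑 → G) [FellBundle π] : Prop where
  exists_one : ∃ e : Fiber π 1, ∀ b : Fiber π 1, e * b = b ∧ b * e = b

theorem norm_mk'_val {g : G} (s : Fiber π g) : ‖Fiber.mk' π s.val‖ = ‖s‖ := by
  obtain ⟨s, rfl⟩ := s
  rfl

/-- Transport along an equality of base points. -/
def Fiber.cast {g h : G} (e : g = h) : Fiber π g →ₗ[ℂ] Fiber π h where
  toFun s := ⟨s.val, s.proj_val.trans e⟩
  map_add' s t := by subst e; rfl
  map_smul' c s := by subst e; rfl

/-- `(s, t) ↦ s t` on `B_g × B_h`, with values in the fiber `B_k`, `k = gh`. -/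
def fiberMul (π : 𝓑 → G) [FellBundle π] {g h k : G} (e : g * h = k) :
    Fiber π g →ₗ[ℂ] Fiber π h →ₗ[ℂ] Fiber π k :=
  LinearMap.mk₂ ℂ (fun s t => Fiber.cast e (s.mul FellBundle.proj_mul t))
    (fun s s' t => by rw [FellBundle.add_mul, map_add])
    (fun c s t => by rw [FellBundle.smul_mul, map_smul])
    (fun s t t' => by rw [FellBundle.mul_add, map_add])
    (fun c s t => by rw [FellBundle.mul_smul, map_smul])

/-- `s ↦ s*` on `B_g`, with values in the fiber `B_k`, `k = g⁻¹`. -/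
def fiberStar (π : 𝓑 → G) [FellBundle π] {g k : G} (e : g⁻¹ = k) :
    Fiber π g →ₛₗ[starRingEnd ℂ] Fiber π k where
  toFun s := Fiber.cast e (s.adj FellBundle.proj_star)
  map_add' s t := by rw [FellBundle.star_add, map_add]
  map_smul' c s := by rw [FellBundle.star_smul, map_smul]

@[simp] theorem fiberMul_val {g h k : G} (e : g * h = k) (s : Fiber π g) (t : Fiber π h) :
    (fiberMul π e s t).val = s.val * t.val := rfl

@[simp] theorem fiberStar_val {g k : G} (e : g⁻¹ = k) (s : Fiber π g) :
    (fiberStar π e s).val = star s.val := rfl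

@[simp] theorem unitFiber_mul_val (a b : Fiber π 1) : (a * b).val = a.val * b.val := rfl

@[simp] theorem unitFiber_star_val (a : Fiber π 1) : (star a).val = star a.val := rfl

theorem unitFiber_mul_eq (a b : Fiber π 1) : a * b = fiberMul π (mul_one 1) a b := rfl

theorem unitFiber_star_eq (a : Fiber π 1) : star a = fiberStar π inv_one a := rfl

/-- The ring structure of a unital unit fiber. -/
@[reducible] noncomputable def unitFiberRing (π : 𝓑 → G) [FellBundle π] [HasUnitalUnitFiber π] :
    Ring (Fiber π 1) where
  __ := (inferInstance : AddCommGroup (Fiber π 1))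
  mul := (· * ·)
  one := (HasUnitalUnitFiber.exists_one (π := π)).choose
  one_mul b := ((HasUnitalUnitFiber.exists_one (π := π)).choose_spec b).1
  mul_one b := ((HasUnitalUnitFiber.exists_one (π := π)).choose_spec b).2
  mul_assoc a b c := Fiber.ext (mul_assoc _ _ _)
  left_distrib a b c := map_add (fiberMul π (mul_one 1) a) b c
  right_distrib a b c := LinearMap.map_add₂ (fiberMul π (mul_one 1)) a b c
  zero_mul a := LinearMap.map_zero₂ (fiberMul π (mul_one 1)) a
  mul_zero a := map_zero (fiberMul π (mul_one 1) a)

/-- The unit fiber, with the operations of the bundle, is a C⋆-algebra; it is unital here. -/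
noncomputable instance unitFiberCStarAlgebra [HasUnitalUnitFiber π] :
    CStarAlgebra (Fiber π 1) where
  __ := unitFiberRing π
  __ := (inferInstance : NormedAddCommGroup (Fiber π 1))
  __ := (inferInstance : CompleteSpace (Fiber π 1))
  toAlgebra :=
    letI := unitFiberRing π
    Algebra.ofModule (fun c a b => LinearMap.map_smul₂ (fiberMul π (mul_one 1)) c a b)
      (fun c a b => map_smul (fiberMul π (mul_one 1) a) c b)
  norm_mul_le a b := by
    have := FellBundle.norm_mul_le (π := π) a.val b.val
    rwa [norm_mk'_val, norm_mk'_val, ← unitFiber_mul_val, norm_mk'_val] at this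
  star := star
  star_involutive a := Fiber.ext (star_star _)
  star_mul a b := Fiber.ext (star_mul _ _)
  star_add a b := map_add (fiberStar π inv_one) a b
  norm_mul_self_le a := by
    have := FellBundle.norm_star_mul_self (π := π) a.val
    rw [norm_mk'_val, ← unitFiber_star_val, ← unitFiber_mul_val, norm_mk'_val, sq] at this
    exact this.ge
  norm_smul_le c a := _root_.norm_smul_le c a
  star_smul c a := LinearMap.map_smulₛₗ (fiberStar π inv_one) c a

end UnitFiber

/-! ### Saturated bundles and crossed product bundles -/

section Properties

variable {𝓑 : Type u} {G : Type v} [TopologicalSpace 𝓑] [TopologicalSpace G] [Group G]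
  [Semigroup 𝓑] [StarMul 𝓑]

/-- The linear span of `B_g B_h` is dense in `B_{gh}` for all `g`, `h`. -/
def IsSaturated (π : 𝓑 → G) [FellBundle π] : Prop :=
  ∀ g h : G, Dense (Submodule.span ℂ
    {x : Fiber π (g * h) | ∃ (s : Fiber π g) (t : Fiber π h), x.val = s.val * t.val} :
      Set (Fiber π (g * h)))

/-- `u u* = u* u = 1` in the unit fiber. -/
def IsUnitaryElement (π : 𝓑 → G) [FellBundle π] [HasUnitalUnitFiber π] (u : 𝓑) : Prop :=
  u * star u = (1 : Fiber π 1).val ∧ star u * u = (1 : Fiber π 1).val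

/-- Every fiber contains a unitary element. -/
def IsCrossedProductBundle (π : 𝓑 → G) [FellBundle π] [HasUnitalUnitFiber π] : Prop :=
  ∀ g : G, ∃ u : 𝓑, π u = g ∧ IsUnitaryElement π u

end Properties

/-! ### Morita equivalence bimodules, the Picard group and outer automorphisms -/

section Picard

/-- A Morita equivalence (imprimitivity) bimodule over the unital C⋆-algebra `B`: a complex vector
space with commuting left and right `B`-actions and with left and right `B`-valued inner products
which make it a full left and a full right Hilbert `B`-module and are compatible.  The norm
`‖x‖ = ‖⟨x, x⟩‖ ^ (1/2)` is the same for both inner products. -/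
structure MoritaBimodule (B : Type u) [CStarAlgebra B] where
  carrier : Type u
  [normedAddCommGroup : NormedAddCommGroup carrier]
  [normedSpace : NormedSpace ℂ carrier]
  [completeSpace : CompleteSpace carrier]
  /-- `left b x = b x` -/
  left : B →ₗ[ℂ] carrier →ₗ[ℂ] carrier
  /-- `right x b = x b` -/
  right : carrier →ₗ[ℂ] B →ₗ[ℂ] carrier
  /-- the left inner product, conjugate linear in the second variable -/
  linner : carrier →ₗ[ℂ] carrier →ₛₗ[starRingEnd ℂ] B
  /-- the right inner product, conjugate linear in the first variable -/
  rinner : carrier →ₛₗ[starRingEnd ℂ] carrier →ₗ[ℂ] B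
  one_left : ∀ x, left 1 x = x
  mul_left : ∀ a b x, left (a * b) x = left a (left b x)
  right_one : ∀ x, right x 1 = x
  right_mul : ∀ x a b, right x (a * b) = right (right x a) b
  left_right : ∀ a x b, right (left a x) b = left a (right x b)
  linner_left : ∀ b x y, linner (left b x) y = b * linner x y
  star_linner : ∀ x y, star (linner x y) = linner y x
  linner_self_nonneg : ∀ x, ∃ b : B, linner x x = star b * b
  norm_linner_self : ∀ x, ‖linner x x‖ = ‖x‖ ^ 2
  rinner_right : ∀ x y b, rinner x (right y b) = rinner x y * b
  star_rinner : ∀ x y, star (rinner x y) = rinner y x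
  rinner_self_nonneg : ∀ x, ∃ b : B, rinner x x = star b * b
  norm_rinner_self : ∀ x, ‖rinner x x‖ = ‖x‖ ^ 2
  linner_full : Dense (Submodule.span ℂ {b : B | ∃ x y, b = linner x y} : Set B)
  rinner_full : Dense (Submodule.span ℂ {b : B | ∃ x y, b = rinner x y} : Set B)
  rinner_left : ∀ b x y, rinner (left b x) y = rinner x (left (star b) y)
  linner_right : ∀ b x y, linner (right x b) y = linner x (right y (star b))
  left_linner : ∀ x y z, left (linner x y) z = right x (rinner y z)

attribute [instance] MoritaBimodule.normedAddCommGroup MoritaBimodule.normedSpace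
  MoritaBimodule.completeSpace

variable {B : Type u} [CStarAlgebra B]

/-- An isomorphism of Morita equivalence bimodules: a bijective linear map which preserves both
actions and both inner products. -/
structure MoritaBimodule.Iso (M N : MoritaBimodule B) where
  toEquiv : M.carrier ≃ₗ[ℂ] N.carrier
  map_left : ∀ b x, toEquiv (M.left b x) = N.left b (toEquiv x)
  map_right : ∀ x b, toEquiv (M.right x b) = N.right (toEquiv x) b
  map_linner : ∀ x y, N.linner (toEquiv x) (toEquiv y) = M.linner x y
  map_rinner : ∀ x y, N.rinner (toEquiv x) (toEquiv y) = M.rinner x y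

/-- Equivalence of Morita equivalence bimodules. -/
def MoritaBimodule.setoid (B : Type u) [CStarAlgebra B] : Setoid (MoritaBimodule B) where
  r M N := Nonempty (M.Iso N)
  iseqv :=
    { refl := fun M => ⟨⟨LinearEquiv.refl ℂ _, fun _ _ => rfl, fun _ _ => rfl, fun _ _ => rfl,
        fun _ _ => rfl⟩⟩
      symm := fun {M N} ⟨f⟩ => ⟨⟨f.toEquiv.symm,
        fun b x => f.toEquiv.injective (by simp [f.map_left]),
        fun x b => f.toEquiv.injective (by simp [f.map_right]),
        fun x y => by rw [← f.map_linner]; simp,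
        fun x y => by rw [← f.map_rinner]; simp⟩⟩
      trans := fun {M N P} ⟨f⟩ ⟨h⟩ => ⟨⟨f.toEquiv.trans h.toEquiv,
        fun b x => by simp [f.map_left, h.map_left],
        fun x b => by simp [f.map_right, h.map_right],
        fun x y => by simp [f.map_linner, h.map_linner],
        fun x y => by simp [f.map_rinner, h.map_rinner]⟩⟩ }

/-- The Picard group of `B` (its underlying set): the equivalence classes of Morita equivalence
bimodules over `B`. -/
def Pic (B : Type u) [CStarAlgebra B] : Type (u + 1) := Quotient (MoritaBimodule.setoid B)

/-- The class `[M]` in the Picard group. -/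
def Pic.mk (M : MoritaBimodule B) : Pic B := Quotient.mk (MoritaBimodule.setoid B) M

/-- The bimodule `M_α`, for a ⋆-automorphism `α` of `B`: the left Hilbert module `B`, with
`s . b = s α(b)` and `⟨s, t⟩ = α⁻¹(s* t)` on the right. -/
noncomputable def autBimodule (α : B ≃⋆ₐ[ℂ] B) : MoritaBimodule B where
  carrier := B
  left := LinearMap.mul ℂ B
  right := LinearMap.mk₂ ℂ (fun s b => s * α b) (fun _ _ _ => by rw [add_mul])
    (fun _ _ _ => by rw [smul_mul_assoc]) (fun _ _ _ => by rw [map_add, mul_add])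
    (fun _ _ _ => by rw [map_smul, mul_smul_comm])
  linner := LinearMap.mk₂'ₛₗ (RingHom.id ℂ) (starRingEnd ℂ) (fun s t => s * star t)
    (fun _ _ _ => by rw [add_mul]) (fun _ _ _ => by simp)
    (fun _ _ _ => by rw [star_add, mul_add]) (fun _ _ _ => by simp)
  rinner := LinearMap.mk₂'ₛₗ (starRingEnd ℂ) (RingHom.id ℂ) (fun s t => α.symm (star s * t))
    (fun _ _ _ => by rw [star_add, add_mul, map_add])
    (fun _ _ _ => by rw [star_smul, smul_mul_assoc, map_smul]; rfl)
    (fun _ _ _ => by rw [mul_add, map_add]) (fun _ _ _ => by rw [mul_smul_comm, map_smul]; rfl)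
  one_left x := one_mul x
  mul_left a b x := mul_assoc a b x
  right_one x := by simp
  right_mul x a b := by simp [mul_assoc]
  left_right a x b := by simp [mul_assoc]
  linner_left b x y := by simp [mul_assoc]
  star_linner x y := by simp
  linner_self_nonneg x := ⟨star x, by simp⟩
  norm_linner_self x := by simp [CStarRing.norm_self_mul_star, sq]
  rinner_right x y b := by simp [mul_assoc]
  star_rinner x y := by simp [← map_star]
  rinner_self_nonneg x := ⟨α.symm x, by simp [map_star]⟩
  norm_rinner_self x := by
    change ‖α.symm (star x * x)‖ = _
    rw [NonUnitalStarAlgHom.norm_map α.symm α.symm.injective, CStarRing.norm_star_mul_self, sq]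
  linner_full := by
    convert dense_univ
    refine Set.eq_univ_of_forall fun b => Submodule.subset_span ⟨b, 1, by simp⟩
  rinner_full := by
    convert dense_univ
    refine Set.eq_univ_of_forall fun b => Submodule.subset_span ⟨1, α b, by simp⟩
  rinner_left b x y := by simp [mul_assoc]
  linner_right b x y := by simp [mul_assoc, map_star]
  left_linner x y z := by simp [mul_assoc]

/-- The inner automorphisms `b ↦ u b u*`, `u` a unitary of `B`. -/
def innerAut (B : Type u) [CStarAlgebra B] : Subgroup (B ≃⋆ₐ[ℂ] B) :=
  (Unitary.conjStarAlgAut ℂ B).range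

instance innerAut_normal : (innerAut B).Normal where
  conj_mem := by
    rintro _ ⟨w, rfl⟩ α
    refine ⟨⟨α w, ?_, ?_⟩, ?_⟩
    · rw [← map_star, ← map_mul, Unitary.star_mul_self_of_mem w.2, map_one]
    · rw [← map_star, ← map_mul, Unitary.mul_star_self_of_mem w.2, map_one]
    · ext x
      change α w * x * star (α w) = α (w * α.symm x * star (w : B))
      simp [map_star]

/-- The outer automorphism group `Out(B) = Aut(B) / Inn(B)`. -/
abbrev Out (B : Type u) [CStarAlgebra B] : Type u := (B ≃⋆ₐ[ℂ] B) ⧸ innerAut B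

theorem autBimodule_iso_of_inner (α β : B ≃⋆ₐ[ℂ] B) (h : α⁻¹ * β ∈ innerAut B) :
    Nonempty ((autBimodule β).Iso (autBimodule α)) := by
  obtain ⟨w, hw⟩ := h
  have hβ : β = α * Unitary.conjStarAlgAut ℂ B w := by rw [hw]; simp
  subst hβ
  have h1 : α (w : B) * α (star (w : B)) = 1 := by
    rw [← map_mul, Unitary.mul_star_self_of_mem w.2, map_one]
  have h2 : α (star (w : B)) * α (w : B) = 1 := by
    rw [← map_mul, Unitary.star_mul_self_of_mem w.2, map_one]
  let e : B ≃ₗ[ℂ] B :=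
    { toFun := fun s => s * α w
      map_add' := fun s t => add_mul _ _ _
      map_smul' := fun c s => smul_mul_assoc _ _ _
      invFun := fun s => s * α (star (w : B))
      left_inv := fun s => by
        change s * α w * α (star (w : B)) = s
        rw [mul_assoc, h1, mul_one]
      right_inv := fun s => by
        change s * α (star (w : B)) * α w = s
        rw [mul_assoc, h2, mul_one] }
  have e1 : ∀ b x : B, b * x * α w = b * (x * α w) := fun b x => mul_assoc _ _ _
  have e2 : ∀ x b : B, x * α (w * b * star (w : B)) * α w = x * α w * α b := fun x b => by
    rw [map_mul, map_mul]
    simp only [mul_assoc, h2, mul_one]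
  have e3 : ∀ x y : B, x * α w * star (y * α w) = x * star y := fun x y => by
    rw [star_mul, ← map_star, mul_assoc, ← mul_assoc (α (w : B)), h1, one_mul]
  have e4 : ∀ x y : B, α.symm (star (x * α w) * (y * α w)) =
      star (w : B) * α.symm (star x * y) * w := fun x y => by
    apply α.injective
    rw [map_mul, map_mul]
    simp [← map_star, mul_assoc]
  exact ⟨⟨e, e1, e2, e3, e4⟩⟩

/-- The embedding `Out(B) → Pic(B)`, `[α] ↦ [M_α]`. -/
noncomputable def outToPic (B : Type u) [CStarAlgebra B] : Out B → Pic B :=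
  Quotient.lift (fun α : B ≃⋆ₐ[ℂ] B => Pic.mk (autBimodule α)) fun α β h =>
    (Quotient.sound (s := MoritaBimodule.setoid B)
      (autBimodule_iso_of_inner α β (QuotientGroup.leftRel_apply.mp h))).symm

theorem outToPic_mk (α : B ≃⋆ₐ[ℂ] B) :
    outToPic B (α : Out B) = Pic.mk (autBimodule α) := rfl

/-- `Out(B)` is a subset of `Pic(B)`. -/
theorem outToPic_injective : Function.Injective (outToPic B) := by
  intro a b
  induction a using QuotientGroup.induction_on with | _ α => ?_
  induction b using QuotientGroup.induction_on with | _ β => ?_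
  intro h
  obtain ⟨f⟩ : Nonempty ((autBimodule α).Iso (autBimodule β)) :=
    Quotient.exact (s := MoritaBimodule.setoid B) h
  let φ : B → B := f.toEquiv
  have e1 : ∀ b x : B, φ (b * x) = b * φ x := f.map_left
  have e2 : ∀ x b : B, φ (x * α b) = φ x * β b := f.map_right
  have e3 : φ 1 * star (φ 1) = 1 * star 1 := f.map_linner (1 : B) (1 : B)
  have e4 : β.symm (star (φ 1) * φ 1) = α.symm (star 1 * 1) := f.map_rinner (1 : B) (1 : B)
  have h1 : φ 1 * star (φ 1) = 1 := by simpa using e3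
  have h2 : star (φ 1) * φ 1 = 1 := by simpa using congrArg β e4
  have h3 : ∀ b, α b * φ 1 = φ 1 * β b := fun b => by rw [← e2, one_mul, ← e1, mul_one]
  refine QuotientGroup.eq.mpr ⟨⟨α.symm (star (φ 1)), ?_, ?_⟩, ?_⟩
  · rw [← map_star, ← map_mul, star_star, h1, map_one]
  · rw [← map_star, ← map_mul, star_star, h2, map_one]
  ext x
  change α.symm (star (φ 1)) * x * star (α.symm (star (φ 1))) = α.symm (β x)
  calc α.symm (star (φ 1)) * x * star (α.symm (star (φ 1)))
      = α.symm (star (φ 1) * (α x * φ 1)) := by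
        rw [← map_star, star_star, map_mul, map_mul, mul_assoc]; simp
    _ = α.symm (β x) := by rw [h3, ← mul_assoc, h2, one_mul]

end Picard

/-! ### The Picard homomorphism of a saturated Fell bundle -/

section PicardMap

variable {𝓑 : Type u} {G : Type v} [TopologicalSpace 𝓑] [TopologicalSpace G] [Group G]
  [Semigroup 𝓑] [StarMul 𝓑] {π : 𝓑 → G} [FellBundle π]

theorem norm_fiberStar {g k : G} (e : g⁻¹ = k) (s : Fiber π g) : ‖fiberStar π e s‖ = ‖s‖ := by
  have key : ∀ s : 𝓑, ‖Fiber.mk' π s‖ ≤ ‖Fiber.mk' π (star s)‖ := fun s => by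
    have h1 := FellBundle.norm_star_mul_self (π := π) s
    have h2 := FellBundle.norm_mul_le (π := π) (star s) s
    have h3 := norm_nonneg (Fiber.mk' π s)
    have h4 := norm_nonneg (Fiber.mk' π (star s))
    by_contra! h
    nlinarith
  have h1 := key s.val
  have h2 := key (star s.val)
  rw [star_star] at h2
  rw [← fiberStar_val e, norm_mk'_val, norm_mk'_val] at h1 h2
  exact le_antisymm h2 h1

theorem norm_mul_star_self {g k : G} (e : g * g⁻¹ = k) (s : Fiber π g) :
    ‖fiberMul π e s (fiberStar π rfl s)‖ = ‖s‖ ^ 2 := by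
  have h := FellBundle.norm_star_mul_self (π := π) (fiberStar π rfl s).val
  rw [norm_mk'_val, norm_fiberStar] at h
  rw [← h, ← norm_mk'_val]
  exact congrArg (fun t : 𝓑 => ‖Fiber.mk' π t‖) (by simp)

theorem norm_star_mul_self' {g k : G} (e : g⁻¹ * g = k) (s : Fiber π g) :
    ‖fiberMul π e (fiberStar π rfl s) s‖ = ‖s‖ ^ 2 := by
  have h := FellBundle.norm_star_mul_self (π := π) s.val
  rw [norm_mk'_val] at h
  rw [← h, ← norm_mk'_val]
  exact congrArg (fun t : 𝓑 => ‖Fiber.mk' π t‖) (by simp)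

theorem fiber_one_mul [HasUnitalUnitFiber π] {g : G} (x : Fiber π g) : fiberMul π (one_mul g) 1 x = x := by
  have h := norm_mul_star_self (mul_inv_cancel g) (fiberMul π (one_mul g) 1 x - x)
  have h0 : ∀ y : Fiber π g⁻¹, fiberMul π (mul_inv_cancel g) (fiberMul π (one_mul g) 1 x - x) y
      = 0 := fun y => by
    rw [LinearMap.map_sub₂, sub_eq_zero]
    have h1 : (1 : Fiber π 1) * fiberMul π (mul_inv_cancel g) x y
        = fiberMul π (mul_inv_cancel g) x y := one_mul _
    rw [← h1]
    exact Fiber.ext (mul_assoc _ _ _)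
  rw [h0, norm_zero] at h
  rw [← sub_eq_zero, ← norm_eq_zero]
  exact pow_eq_zero_iff two_ne_zero |>.mp h.symm

theorem fiber_mul_one [HasUnitalUnitFiber π] {g : G} (x : Fiber π g) : fiberMul π (mul_one g) x 1 = x := by
  have h := norm_star_mul_self' (inv_mul_cancel g) (fiberMul π (mul_one g) x 1 - x)
  have h0 : ∀ y : Fiber π g⁻¹, fiberMul π (inv_mul_cancel g) y (fiberMul π (mul_one g) x 1 - x)
      = 0 := fun y => by
    rw [map_sub, sub_eq_zero]
    have h1 : fiberMul π (inv_mul_cancel g) y x * (1 : Fiber π 1)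
        = fiberMul π (inv_mul_cancel g) y x := mul_one _
    rw [← h1]
    exact Fiber.ext (mul_assoc _ _ _).symm
  rw [h0, norm_zero] at h
  rw [← sub_eq_zero, ← norm_eq_zero]
  exact pow_eq_zero_iff two_ne_zero |>.mp h.symm

theorem IsSaturated.dense (hsat : IsSaturated π) {g h k : G} (e : g * h = k) :
    Dense (Submodule.span ℂ
      {x : Fiber π k | ∃ (s : Fiber π g) (t : Fiber π h), x.val = s.val * t.val} :
        Set (Fiber π k)) := by
  subst e
  exact hsat g h

/-- The fiber `B_g` of a saturated Fell bundle as a Morita equivalence bimodule over `B_e`: the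
actions are given by the multiplication, the inner products are `s t*` and `s* t`. -/
noncomputable def fiberBimodule [HasUnitalUnitFiber π] (hsat : IsSaturated π) (g : G) :
    MoritaBimodule (Fiber π 1) where
  carrier := Fiber π g
  left := fiberMul π (one_mul g)
  right := fiberMul π (mul_one g)
  linner := (fiberMul π (mul_inv_cancel g)).compl₂ (fiberStar π rfl)
  rinner := (fiberMul π (inv_mul_cancel g)).comp (fiberStar π rfl)
  one_left := fiber_one_mul
  mul_left a b x := Fiber.ext (mul_assoc _ _ _)
  right_one := fiber_mul_one
  right_mul x a b := Fiber.ext (mul_assoc _ _ _).symm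
  left_right a x b := Fiber.ext (mul_assoc _ _ _)
  linner_left b x y := Fiber.ext (mul_assoc _ _ _)
  star_linner x y := Fiber.ext (by simp)
  linner_self_nonneg x := by
    obtain ⟨b, hb, hx⟩ := FellBundle.star_mul_self_nonneg (π := π) (star x.val)
    exact ⟨⟨b, hb⟩, Fiber.ext (by simpa using hx)⟩
  norm_linner_self := norm_mul_star_self (mul_inv_cancel g)
  rinner_right x y b := Fiber.ext (mul_assoc _ _ _).symm
  star_rinner x y := Fiber.ext (by simp)
  rinner_self_nonneg x := by
    obtain ⟨b, hb, hx⟩ := FellBundle.star_mul_self_nonneg (π := π) x.val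
    exact ⟨⟨b, hb⟩, Fiber.ext (by simpa using hx)⟩
  norm_rinner_self := norm_star_mul_self' (inv_mul_cancel g)
  linner_full := by
    refine (hsat.dense (mul_inv_cancel g)).mono (Submodule.span_mono ?_)
    rintro x ⟨s, t, hx⟩
    exact ⟨s, fiberStar π (inv_inv g) t, Fiber.ext (by simpa using hx)⟩
  rinner_full := by
    refine (hsat.dense (inv_mul_cancel g)).mono (Submodule.span_mono ?_)
    rintro x ⟨s, t, hx⟩
    exact ⟨fiberStar π (inv_inv g) s, t, Fiber.ext (by simpa using hx)⟩
  rinner_left b x y := Fiber.ext (by simp [mul_assoc])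
  linner_right b x y := Fiber.ext (by simp [mul_assoc])
  left_linner x y z := Fiber.ext (by simp [mul_assoc])

/-- The Picard homomorphism `ψ(g) = [B_g]` of a saturated Fell bundle. -/
noncomputable def picardMap [HasUnitalUnitFiber π] (hsat : IsSaturated π) (g : G) :
    Pic (Fiber π 1) :=
  Pic.mk (fiberBimodule hsat g)

end PicardMap

/-! A unitary `u` in `B_g` is invertible with inverse `u*` in `B_{g⁻¹}`, and everything follows from
cancelling `u u*` and `u* u`. Writing `s = u (u* s) = (s u*) u` gives `B_g = u B_e = B_e u`, and the
first factorization, applied to `s` in `B_{gh}`, gives `B_g B_h = B_{gh}`; saturation is then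
immediate.

The link with `Pic(B_e)` is a correspondence between unitaries of `B_g` and bimodule isomorphisms
`M_α ≅ B_g`. Given `u`, put `α(b) = u b u*`; then `b ↦ b u` is such an isomorphism
(`IsUnitaryElement.fiberIso`), the twist by `α` being what is needed to move `b` past `u`: `α(b) u =
u b`. Given an isomorphism `f`, the element `f(1)` is unitary because `1` has both inner squares
equal to `1` in `M_α` and `f` preserves both inner products (`isUnitaryElement_of_iso`). -/

section UnitaryElements

variable {𝓑 : Type u} {G : Type v} [TopologicalSpace 𝓑] [TopologicalSpace G] [Group G]
  [Semigroup 𝓑] [StarMul 𝓑] {π : 𝓑 → G} [FellBundle π] [HasUnitalUnitFiber π]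

/-! ### Cancellation rules for unitary elements -/

variable (π) in
-- The unit is assumed to be one for `B_e` only; it acts trivially on the other fibers by the
-- C⋆-identity (`fiber_one_mul`). Stated in the semigroup `𝓑`, the rule can be combined with
-- associativity without transport between fibers.
theorem one_val_mul (s : 𝓑) : (1 : Fiber π 1).val * s = s :=
  congrArg Fiber.val (fiber_one_mul (Fiber.mk' π s))

variable (π) in
theorem mul_one_val (s : 𝓑) : s * (1 : Fiber π 1).val = s :=
  congrArg Fiber.val (fiber_mul_one (Fiber.mk' π s))

theorem IsUnitaryElement.star_mul_cancel_left {u : 𝓑} (hu : IsUnitaryElement π u) (s : 𝓑) :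
    star u * (u * s) = s := by
  rw [← mul_assoc, hu.2, one_val_mul]

theorem IsUnitaryElement.mul_star_cancel_left {u : 𝓑} (hu : IsUnitaryElement π u) (s : 𝓑) :
    u * (star u * s) = s := by
  rw [← mul_assoc, hu.1, one_val_mul]

theorem IsUnitaryElement.mul_star_cancel_right {u : 𝓑} (hu : IsUnitaryElement π u) (s : 𝓑) :
    s * u * star u = s := by
  rw [mul_assoc, hu.1, mul_one_val]

theorem IsUnitaryElement.star_mul_cancel_right {u : 𝓑} (hu : IsUnitaryElement π u) (s : 𝓑) :
    s * star u * u = s := by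
  rw [mul_assoc, hu.2, mul_one_val]

/-! ### Fibers and products of fibers -/

/-- A fiber with a unitary element `u` is `u B_e`. -/
theorem IsUnitaryElement.fiber_eq_left {g : G} {u : 𝓑} (hu : IsUnitaryElement π u)
    (hg : π u = g) : {s : 𝓑 | π s = g} = {s : 𝓑 | ∃ b : 𝓑, π b = 1 ∧ s = u * b} := by
  ext s
  constructor
  · intro hs
    refine ⟨star u * s, ?_, (hu.mul_star_cancel_left s).symm⟩
    rw [FellBundle.proj_mul (π := π), FellBundle.proj_star (π := π), hg, Set.mem_ofPred.mp hs,
      inv_mul_cancel]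
  · rintro ⟨b, hb, rfl⟩
    rw [Set.mem_ofPred, FellBundle.proj_mul (π := π), hg, hb, mul_one]

/-- A fiber with a unitary element `u` is `B_e u`. -/
theorem IsUnitaryElement.fiber_eq_right {g : G} {u : 𝓑} (hu : IsUnitaryElement π u)
    (hg : π u = g) : {s : 𝓑 | π s = g} = {s : 𝓑 | ∃ b : 𝓑, π b = 1 ∧ s = b * u} := by
  ext s
  constructor
  · intro hs
    refine ⟨s * star u, ?_, (hu.star_mul_cancel_right s).symm⟩
    rw [FellBundle.proj_mul (π := π), FellBundle.proj_star (π := π), hg, Set.mem_ofPred.mp hs,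
      mul_inv_cancel]
  · rintro ⟨b, hb, rfl⟩
    rw [Set.mem_ofPred, FellBundle.proj_mul (π := π), hg, hb, one_mul]

/-- In a crossed product bundle `B_g B_h = B_{gh}`. -/
theorem IsCrossedProductBundle.fiber_mul_eq (hπ : IsCrossedProductBundle π) (g h : G) :
    {s : 𝓑 | π s = g * h} = {s : 𝓑 | ∃ a b : 𝓑, π a = g ∧ π b = h ∧ s = a * b} := by
  ext s
  constructor
  · intro hs
    obtain ⟨u, hg, hu⟩ := hπ g
    -- Only the fiber over `g` has to contain a unitary: `u* s` lies over `g⁻¹ (g h) = h`.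
    refine ⟨u, star u * s, hg, ?_, (hu.mul_star_cancel_left s).symm⟩
    rw [FellBundle.proj_mul (π := π), FellBundle.proj_star (π := π), hg, Set.mem_ofPred.mp hs,
      inv_mul_cancel_left]
  · rintro ⟨a, b, ha, hb, rfl⟩
    rw [Set.mem_ofPred, FellBundle.proj_mul (π := π), ha, hb]

/-- Every element of `B_{gh}` is already a single product, so neither the span nor the closure is
needed. -/
theorem IsCrossedProductBundle.isSaturated (hπ : IsCrossedProductBundle π) : IsSaturated π := by
  intro g h x
  refine subset_closure (Submodule.subset_span ?_)
  obtain ⟨a, b, ha, hb, hx⟩ := (hπ.fiber_mul_eq g h).subset x.proj_val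
  exact ⟨⟨a, ha⟩, ⟨b, hb⟩, hx⟩

/-! ### Unitary elements and isomorphisms with `M_α` -/

/-- Conjugation `b ↦ u b u*` of the unit fiber by a unitary element `u` of the bundle. -/
noncomputable def IsUnitaryElement.conjAut {u : 𝓑} (hu : IsUnitaryElement π u) :
    Fiber π 1 ≃⋆ₐ[ℂ] Fiber π 1 where
  toFun b := ⟨u * b.val * star u, by
    rw [FellBundle.proj_mul (π := π), FellBundle.proj_mul (π := π),
      FellBundle.proj_star (π := π), b.proj_val, mul_one, mul_inv_cancel]⟩
  invFun b := ⟨star u * b.val * u, by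
    rw [FellBundle.proj_mul (π := π), FellBundle.proj_mul (π := π),
      FellBundle.proj_star (π := π), b.proj_val, mul_one, inv_mul_cancel]⟩
  left_inv b := Fiber.ext (by
    simp only [mul_assoc, hu.star_mul_cancel_left]
    -- The last pair `u* u` has no factor to its right, so the cancellation rule used above does not
    -- reach it.
    rw [hu.2, mul_one_val])
  right_inv b := Fiber.ext (by
    simp only [mul_assoc, hu.mul_star_cancel_left]
    rw [hu.1, mul_one_val])
  map_mul' a b := Fiber.ext (by
    simp only [unitFiber_mul_val, mul_assoc, hu.star_mul_cancel_left])
  map_add' a b := by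
    -- Sums exist only within a fiber, so `b ↦ u b u*` is split into two additive maps, `B_e → B_g`
    -- and `B_g → B_e`.
    have h1 := map_add (fiberMul π (mul_one (π u)) (Fiber.mk' π u)) a b
    have h2 := LinearMap.map_add₂ (fiberMul π (mul_inv_cancel (π u)))
      (fiberMul π (mul_one (π u)) (Fiber.mk' π u) a)
      (fiberMul π (mul_one (π u)) (Fiber.mk' π u) b) (fiberStar π rfl (Fiber.mk' π u))
    rw [← h1] at h2
    exact h2
  map_star' a := Fiber.ext (by simp [mul_assoc])
  map_smul' c a := by
    have h1 := map_smul (fiberMul π (mul_one (π u)) (Fiber.mk' π u)) c a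
    have h2 := LinearMap.map_smul₂ (fiberMul π (mul_inv_cancel (π u))) c
      (fiberMul π (mul_one (π u)) (Fiber.mk' π u) a) (fiberStar π rfl (Fiber.mk' π u))
    rw [← h1] at h2
    exact h2

/-- Right multiplication by a unitary element of `B_g`, as an isomorphism of `M_α` and `B_g`, where
`α` is the conjugation by the unitary. -/
noncomputable def IsUnitaryElement.fiberIso (hsat : IsSaturated π) {g : G} (u : Fiber π g)
    (hu : IsUnitaryElement π u.val) :
    (autBimodule hu.conjAut).Iso (fiberBimodule hsat g) where
  toEquiv :=
    { (fiberMul π (one_mul g)).flip u with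
      invFun := fun x => fiberMul π (mul_inv_cancel g) x (fiberStar π rfl u)
      left_inv := fun b => Fiber.ext (hu.mul_star_cancel_right b.val)
      right_inv := fun x => Fiber.ext (hu.star_mul_cancel_right x.val) }
  map_left b x := Fiber.ext (mul_assoc b.val x.val u.val)
  -- The right action of `M_α` is `x α(b)`, and the final `u*` of `α(b)` cancels against `u`.
  map_right x b := Fiber.ext (by
    change x.val * (u.val * b.val * star u.val) * u.val = x.val * u.val * b.val
    simp only [← mul_assoc, hu.star_mul_cancel_right])
  map_linner x y := Fiber.ext (by
    change x.val * u.val * star (y.val * u.val) = x.val * star y.val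
    rw [star_mul, ← mul_assoc, hu.mul_star_cancel_right])
  -- The inner product of `M_α` is `α⁻¹(x* y)`, where `α⁻¹` is `b ↦ u* b u`.
  map_rinner x y := Fiber.ext (by
    change star (x.val * u.val) * (y.val * u.val) = star u.val * (star x.val * y.val) * u.val
    simp only [star_mul, mul_assoc])

/-- The image of `1` under an isomorphism of `M_α` with `B_g` is a unitary element. -/
theorem isUnitaryElement_of_iso (hsat : IsSaturated π) {g : G}
    (α : Fiber π 1 ≃⋆ₐ[ℂ] Fiber π 1) (f : (autBimodule α).Iso (fiberBimodule hsat g)) :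
    IsUnitaryElement π (Fiber.val (π := π) (x := g) (f.toEquiv (1 : Fiber π 1))) := by
  have h1 : (fiberBimodule hsat g).linner (f.toEquiv (1 : Fiber π 1)) (f.toEquiv (1 : Fiber π 1))
      = (1 : Fiber π 1) * star (1 : Fiber π 1) := f.map_linner (1 : Fiber π 1) (1 : Fiber π 1)
  have h2 : (fiberBimodule hsat g).rinner (f.toEquiv (1 : Fiber π 1)) (f.toEquiv (1 : Fiber π 1))
      = α.symm (star (1 : Fiber π 1) * (1 : Fiber π 1)) :=
    f.map_rinner (1 : Fiber π 1) (1 : Fiber π 1)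
  rw [star_one, mul_one] at h1
  rw [star_one, mul_one, map_one] at h2
  exact ⟨congrArg Fiber.val h1, congrArg Fiber.val h2⟩

/-! ### The characterization by the Picard homomorphism -/

theorem isCrossedProductBundle_iff : IsCrossedProductBundle π ↔ ∃ hsat : IsSaturated π,
    ∀ g : G, picardMap hsat g ∈ Set.range (outToPic (Fiber π 1)) := by
  constructor
  · refine fun hπ => ⟨hπ.isSaturated, fun g => ?_⟩
    obtain ⟨u, hg, hu⟩ := hπ g
    exact ⟨(hu.conjAut : Out (Fiber π 1)), Quotient.sound (s := MoritaBimodule.setoid _)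
      ⟨IsUnitaryElement.fiberIso hπ.isSaturated ⟨u, hg⟩ hu⟩⟩
  · rintro ⟨hsat, hπ⟩ g
    obtain ⟨a, ha⟩ := hπ g
    induction a using QuotientGroup.induction_on with | _ α => ?_
    -- After a representative `α` of the outer class is chosen, equality in `Pic(B_e)` is the
    -- existence of a bimodule isomorphism; the unitary over `g` is the image of `1`.
    obtain ⟨f⟩ : Nonempty ((autBimodule α).Iso (fiberBimodule hsat g)) :=
      Quotient.exact (s := MoritaBimodule.setoid _) ha
    exact ⟨_, Fiber.proj_val (π := π) (x := g) (f.toEquiv (1 : Fiber π 1)),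
      isUnitaryElement_of_iso hsat α f⟩

end UnitaryElements

theorem mainTheorem8 {G : Type v} [Group G] [TopologicalSpace G] [IsTopologicalGroup G]
    [LocallyCompactSpace G] [T2Space G]
    {𝓑 : Type u} [TopologicalSpace 𝓑] [T2Space 𝓑] [Semigroup 𝓑] [StarMul 𝓑]
    (π : 𝓑 → G) [FellBundle π] [HasUnitalUnitFiber π] :
    (IsCrossedProductBundle π ↔
      ∃ hsat : IsSaturated π,
        ∀ g : G, picardMap hsat g ∈ Set.range (outToPic (Fiber π 1))) ∧
    (IsCrossedProductBundle π →
      (∀ (g : G) (u : 𝓑), π u = g → IsUnitaryElement π u →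
        {s : 𝓑 | π s = g} = {s : 𝓑 | ∃ b : 𝓑, π b = 1 ∧ s = u * b} ∧
        {s : 𝓑 | π s = g} = {s : 𝓑 | ∃ b : 𝓑, π b = 1 ∧ s = b * u}) ∧
      ∀ g h : G,
        {s : 𝓑 | π s = g * h} = {s : 𝓑 | ∃ a b : 𝓑, π a = g ∧ π b = h ∧ s = a * b}) :=
  ⟨isCrossedProductBundle_iff, fun hπ =>
    ⟨fun _ _ hg hu => ⟨hu.fiber_eq_left hg, hu.fiber_eq_right hg⟩, hπ.fiber_mul_eq⟩⟩
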